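/- Let $\Pi_\ell$ (legitimate nodes) and $\Pi_e$ (eavesdroppers) be independent homogeneous Poisson point processes in $\mathbb{R}^2$ with densities $\lambda_\ell>0$ and $\lambda_e>0$. For $\rho\ge 0$ and a locally finite set $\Phi\subset\mathbb{R}^2$ let $\Theta_\rho(\Phi)=\bigcup_{x\in\Phi}\{z:|z-x|\le\rho\}$, and let $G_\rho(\Phi)$ be the directed graph with vertex set $\Phi$ in which there is an edge from $x$ to $y\ne x$ if and only if $|x-y|<|x-e|$ for every $e\in\Pi_e\setminus\Theta_\rho(\Phi)$, i.e. $y$ is closer to $x$ than every eavesdropper that lies at distance greater than $\rho$ from all the nodes. Let $N_{\mathrm{in}}$ and $N_{\mathrm{out}}$ be the in- and out-degree of the node $0$ in the graph $G_\rho(\Pi_\ell\cup\{0\})$, and let expectations take values in $[0,\infty]$. Then, for every $\rho\ge 0$: 1. $N_{\mathrm{in}}$ and $N_{\mathrm{out}}$ are random variables, and their means are the average degrees of a typical node of $G_\rho(\Pi_\ell)$: for every Borel set $W\subset\mathbb{R}^2$ with $0<|W|<\infty$, the expected sum of the in-degrees (respectively out-degrees) in $G_\rho(\Pi_\ell)$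 of the nodes of $\Pi_\ell$ in $W$, divided by the expected number of nodes of $\Pi_\ell$ in $W$, equals $\mathbb{E}\{N_{\mathrm{in}}\}$ (respectively $\mathbb{E}\{N_{\mathrm{out}}\}$). 2. $$\mathbb{E}\{N_{\mathrm{in}}\}=\mathbb{E}\{N_{\mathrm{out}}\}\ \ge\ \frac{\lambda_\ell}{\lambda_e}\left(\pi\lambda_e\rho^2+e^{\pi\lambda_\ell\rho^2}\right).$$ Consequently the average degrees grow at least exponentially in $\rho$: for every real $a$ there is $c>0$ such that $\mathbb{E}\{N_{\mathrm{in}}\}$ and $\mathbb{E}\{N_{\mathrm{out}}\}$ are at least $c\,e^{a\rho}$ for all $\rho\ge0$. -/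

import Mathlib

open MeasureTheory ProbabilityTheory
open scoped ENNReal NNReal

noncomputable section

/-- The plane with the Euclidean distance. -/
abbrev Plane : Type := EuclideanSpace ℝ (Fin 2)

/-- Locally finite sets of points of the plane (configurations). -/
def Config : Type :=
  {φ : Set Plane // ∀ r : ℝ, (φ ∩ Metric.closedBall 0 r).Finite}

/-- The set of points of a configuration. -/
def Config.pts (φ : Config) : Set Plane := φ.1

/-- The number of points of a configuration in a region. -/
def Config.count (φ : Config) (B : Set Plane) : ℕ∞ := (φ.pts ∩ B).encard

/-- The usual σ-algebra on configurations, generated by the counts in Borel regions. -/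
instance Config.instMeasurableSpace : MeasurableSpace Config :=
  ⨆ (B : Set Plane) (_ : MeasurableSet B),
    MeasurableSpace.comap (fun φ : Config => φ.count B) inferInstance

/-- `Π` is a homogeneous Poisson point process in the plane with density `lam`: it is a random
configuration, the number of points in a Borel region of finite area `A` is Poisson with mean
`lam * A`, and the numbers of points in pairwise disjoint Borel regions are independent. -/
structure IsPoissonProcess {Ω : Type*} [MeasurableSpace Ω] (P : Measure Ω)
    (Pi : Ω → Config) (lam : ℝ≥0) : Prop where
  measurable : Measurable Pi
  law : ∀ B : Set Plane, MeasurableSet B → volume B ≠ ∞ → ∀ n : ℕ,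
    P {ω | (Pi ω).count B = n} = poissonMeasure (lam * (volume B).toNNReal) {n}
  indep : ∀ (k : ℕ) (B : Fin k → Set Plane), (∀ i, MeasurableSet (B i)) →
    Pairwise (Function.onFun Disjoint B) →
    iIndepFun (fun (i : Fin k) (ω : Ω) => (Pi ω).count (B i)) P

/-- The total neutralization region: the union of the closed discs of radius `ρ` centred at the
legitimate nodes. -/
def neutralizationRegion (nodes : Set Plane) (ρ : ℝ) : Set Plane :=
  ⋃ x ∈ nodes, Metric.closedBall x ρ

/-- The secrecy graph with neutralization radius `ρ`, on the legitimate nodes `nodes` and the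
eavesdroppers `eaves`: there is an edge from a node `x` to another node `y` when `y` is closer to
`x` than every eavesdropper that is not neutralized. Points that are not nodes are isolated. -/
def secrecyGraph (nodes eaves : Set Plane) (ρ : ℝ) : Digraph Plane where
  Adj x y := x ∈ nodes ∧ y ∈ nodes ∧ x ≠ y ∧
    ∀ e ∈ eaves ∩ (neutralizationRegion nodes ρ)ᶜ, dist x y < dist x e

/-- The number of edges leaving `x`. -/
def outDeg (G : Digraph Plane) (x : Plane) : ℕ∞ := {y | G.Adj x y}.encard

/-- The number of edges entering `x`. -/
def inDeg (G : Digraph Plane) (x : Plane) : ℕ∞ := {y | G.Adj y x}.encard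

/-- The graph on the process of legitimate nodes. -/
def poissonGraph {Ω : Type*} (PiL PiE : Ω → Config) (ρ : ℝ) (ω : Ω) : Digraph Plane :=
  secrecyGraph (PiL ω).pts (PiE ω).pts ρ

/-- The graph after a legitimate node has been added at the origin. -/
def originGraph {Ω : Type*} (PiL PiE : Ω → Config) (ρ : ℝ) (ω : Ω) : Digraph Plane :=
  secrecyGraph (insert 0 (PiL ω).pts) (PiE ω).pts ρ

/-- The out-degree of a node placed at the origin. -/
def Nout {Ω : Type*} (PiL PiE : Ω → Config) (ρ : ℝ) (ω : Ω) : ℕ∞ :=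
  outDeg (originGraph PiL PiE ρ ω) 0

/-- The in-degree of a node placed at the origin. -/
def Nin {Ω : Type*} (PiL PiE : Ω → Config) (ρ : ℝ) (ω : Ω) : ℕ∞ :=
  inDeg (originGraph PiL PiE ρ ω) 0

/-- Expectation, in `[0, ∞]`, of a random variable with values in `ℕ ∪ {∞}`. -/
def mean {Ω : Type*} [MeasurableSpace Ω] (P : Measure Ω) (N : Ω → ℕ∞) : ℝ≥0∞ :=
  ∫⁻ ω, (N ω : ℝ≥0∞) ∂P

/-- The Palm average over the points of `Π` of a quantity `f` attached to them, computed in the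
window `W`: the expected sum of `f` over the points of `Π` in `W`, divided by the expected number
of points of `Π` in `W`. -/
def palmMean {Ω : Type*} [MeasurableSpace Ω] (P : Measure Ω) (Pi : Ω → Config) (W : Set Plane)
    (f : Ω → Plane → ℕ∞) : ℝ≥0∞ :=
  (∫⁻ ω, ∑' x : ↑((Pi ω).pts ∩ W), (f ω x : ℝ≥0∞) ∂P) / mean P (fun ω => (Pi ω).count W)

end

/-! The Mecke formula turns a sum over the legitimate nodes into an integral over the position of
one added node. With stationarity of the pair of processes it identifies the Palm averages with the
means at the origin. Applied to the degrees at the origin, it writes both means as $\lambda_\ell$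
times the integral over $y$ of an edge probability in the graph with nodes $0$, $y$ and $\Pi_\ell$.
Translating by $y$ and reflecting $y\mapsto -y$ exchanges the two edge directions, so the means
agree.

For the lower bound, fix the nodes. The edge $0\to y$ exists exactly when no eavesdropper lies in
the part of the disc of radius $|y|$ outside all neutralization discs, which has probability
$e^{-\lambda_e V}$ for the area $V$ of that part. Forgetting the disc around $y$ only enlarges $V$.
Jensen's inequality then bounds the mean of $e^{-\lambda_e V}$ below by the exponential at the mean
area $e^{-\pi\lambda_\ell\rho^2}\,\pi\max(0,|y|^2-\rho^2)$. Integrating in polar coordinates gives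
the stated expression.

The Mecke formula itself comes from comparing two measures on pairs (configuration, point). Void
events form a π-system generating the σ-algebra, so products of void events with Borel sets of
finite area suffice, and on these the formula is the independence of counts in disjoint regions. -/

theorem measurable_enat_toENNReal : Measurable (fun n : ℕ∞ => (n : ℝ≥0∞)) :=
  measurable_of_countable _

theorem measurable_enat_of_toENNReal {α : Type*} [MeasurableSpace α] {f : α → ℕ∞}
    (hf : Measurable fun a => (f a : ℝ≥0∞)) : Measurable f := by
  refine measurable_to_countable' fun n => ?_
  have : f ⁻¹' {n} = (fun a => (f a : ℝ≥0∞)) ⁻¹' {(n : ℝ≥0∞)} := by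
    ext a; simp
  rw [this]
  exact hf (measurableSet_singleton _)

/-! ### Configurations: counting kernel, measurability, void events -/

namespace Config

theorem finite_inter_of_isBounded (φ : Config) {B : Set Plane} (hB : Bornology.IsBounded B) :
    (φ.pts ∩ B).Finite := by
  obtain ⟨r, hr⟩ := hB.subset_closedBall 0
  exact (φ.2 r).subset (Set.inter_subset_inter_right _ hr)

theorem countable_pts (φ : Config) : φ.pts.Countable := by
  have : φ.pts = ⋃ n : ℕ, φ.pts ∩ Metric.closedBall 0 n := by
    rw [← Set.inter_iUnion, Metric.iUnion_closedBall_nat, Set.inter_univ]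
  rw [this]
  exact Set.countable_iUnion fun n => (φ.2 n).countable

instance (φ : Config) : Countable φ.pts := φ.countable_pts.to_subtype

theorem measurable_count {B : Set Plane} (hB : MeasurableSet B) :
    Measurable fun φ : Config => φ.count B :=
  measurable_iff_comap_le.2 (le_iSup₂_of_le B hB le_rfl)

theorem measurable_of_count {α : Type*} [MeasurableSpace α] {f : α → Config}
    (hf : ∀ B, MeasurableSet B → Measurable fun a => (f a).count B) : Measurable f := by
  refine measurable_iff_comap_le.2 ?_
  simp only [instMeasurableSpace, MeasurableSpace.comap_iSup, MeasurableSpace.comap_comp]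
  exact iSup₂_le fun B hB => measurable_iff_comap_le.1 (hf B hB)

/-- The sum of the Dirac masses at the points of a configuration. -/
noncomputable def pointMeasure (φ : Config) : Measure Plane :=
  Measure.sum fun x : φ.pts => Measure.dirac (x : Plane)

theorem lintegral_pointMeasure (φ : Config) (f : Plane → ℝ≥0∞) :
    ∫⁻ x, f x ∂φ.pointMeasure = ∑' x : φ.pts, f x := by
  simp [pointMeasure, lintegral_sum_measure]

theorem pointMeasure_apply (φ : Config) {B : Set Plane} (hB : MeasurableSet B) :
    φ.pointMeasure B = (φ.count B : ℝ≥0∞) := by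
  rw [← lintegral_indicator_one hB, lintegral_pointMeasure, count,
    ← ENNReal.tsum_set_one, tsum_subtype φ.pts (B.indicator 1),
    tsum_subtype (φ.pts ∩ B) (fun _ => (1 : ℝ≥0∞)), Set.indicator_indicator]
  rfl

/-- The counting measures of the configurations, as a kernel. -/
noncomputable def pointKernel : Kernel Config Plane where
  toFun := pointMeasure
  measurable' := Measure.measurable_of_measurable_coe _ fun B hB => by
    simp only [pointMeasure_apply _ hB]
    exact measurable_enat_toENNReal.comp (measurable_count hB)

theorem pointKernel_apply' (φ : Config) {B : Set Plane} (hB : MeasurableSet B) :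
    pointKernel φ B = (φ.count B : ℝ≥0∞) := φ.pointMeasure_apply hB

theorem lintegral_pointKernel (φ : Config) (f : Plane → ℝ≥0∞) :
    ∫⁻ x, f x ∂(pointKernel φ) = ∑' x : φ.pts, f x := φ.lintegral_pointMeasure f

-- Total masses may be infinite, so the kernel is cut by ring and by the number of points in the
-- ring: on the event of $m$ points in the $n$-th ring, the restriction to that ring has mass $m$.
-- S-finiteness is what makes sums over the points measurable in parameters.
open Classical in
instance : IsSFiniteKernel pointKernel := by
  let A : ℕ → Set Plane := disjointed fun n : ℕ => Metric.closedBall 0 n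
  have hA : ∀ n, MeasurableSet (A n) := fun n =>
    MeasurableSet.disjointed (fun n => measurableSet_closedBall) n
  have hAb : ∀ n, Bornology.IsBounded (A n) := fun n =>
    Metric.isBounded_closedBall.subset (disjointed_subset _ n)
  have hs : ∀ p : ℕ × ℕ, MeasurableSet {φ : Config | φ.count (A p.1) = p.2} := fun p =>
    measurable_count (hA p.1) (measurableSet_singleton _)
  have hκ : pointKernel = Kernel.sum fun p : ℕ × ℕ =>
      Kernel.piecewise (hs p) (pointKernel.restrict (hA p.1)) 0 := by
    ext φ B hB
    rw [Kernel.sum_apply' _ _ hB]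
    refine Eq.trans ?_ (ENNReal.tsum_prod' (f := fun p : ℕ × ℕ =>
      (Kernel.piecewise (hs p) (pointKernel.restrict (hA p.1)) 0) φ B)).symm
    have hU : (⋃ n, A n) = Set.univ := by
      rw [iUnion_disjointed, Metric.iUnion_closedBall_nat]
    have h1 : pointKernel φ B = ∑' n, pointKernel φ (B ∩ A n) := by
      rw [← measure_iUnion (fun i j hij => ((disjoint_disjointed _) hij).mono
        Set.inter_subset_right Set.inter_subset_right) fun n => hB.inter (hA n),
        ← Set.inter_iUnion, hU, Set.inter_univ]
    rw [h1]
    refine tsum_congr fun n => ?_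
    have hfin : φ.count (A n) ≠ ⊤ := by
      rw [count, Set.encard_ne_top_iff]
      exact φ.finite_inter_of_isBounded (hAb n)
    obtain ⟨m, hm⟩ := ENat.ne_top_iff_exists.1 hfin
    rw [tsum_eq_single m]
    · rw [Kernel.piecewise_apply, if_pos (by exact hm.symm), Kernel.restrict_apply' _ _ _ hB]
    · intro k hk
      rw [Kernel.piecewise_apply, if_neg]
      · simp
      · intro h
        have : φ.count (A n) = k := h
        rw [← hm] at this
        exact hk (by exact_mod_cast this.symm)
  have hfin : ∀ p : ℕ × ℕ, IsFiniteKernel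
      (Kernel.piecewise (hs p) (pointKernel.restrict (hA p.1)) 0) := fun p => by
    refine ⟨⟨p.2, by simp, fun φ => ?_⟩⟩
    rw [Kernel.piecewise_apply]
    split_ifs with h
    · rw [Kernel.restrict_apply' _ _ _ .univ, Set.univ_inter, pointKernel_apply' _ (hA _)]
      have : φ.count (A p.1) = p.2 := h
      simp [this]
    · simp
  rw [hκ]
  infer_instance

/-- Sums over the points of a configuration depend measurably on parameters. -/
theorem measurable_lintegral_pointKernel {α : Type*} [MeasurableSpace α] {c : α → Config}
    (hc : Measurable c) {f : α × Plane → ℝ≥0∞} (hf : Measurable f) :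
    Measurable fun a => ∫⁻ x, f (a, x) ∂(pointKernel (c a)) :=
  Measurable.lintegral_kernel_prod_right' (κ := pointKernel.comap c hc) hf

/-- Whether a configuration has a point with a given property depends measurably on parameters. -/
theorem measurableSet_exists_mem {α : Type*} [MeasurableSpace α] {c : α → Config}
    (hc : Measurable c) {s : Set (α × Plane)} (hs : MeasurableSet s) :
    MeasurableSet {a | ∃ x ∈ (c a).pts, (a, x) ∈ s} := by
  have h := measurable_lintegral_pointKernel hc (measurable_one.indicator hs (β := ℝ≥0∞))
  convert (h (measurableSet_singleton 0)).compl using 1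
  ext a
  simp [lintegral_pointKernel]

/-- The configuration with a point added. -/
def insert (x : Plane) (φ : Config) : Config :=
  ⟨Insert.insert x φ.pts, fun r => ((φ.2 r).insert x).subset fun y hy => by
    rcases hy with ⟨rfl | h, h'⟩
    · exact Or.inl rfl
    · exact Or.inr ⟨h, h'⟩⟩

@[simp] theorem insert_pts (x : Plane) (φ : Config) : (insert x φ).pts = Insert.insert x φ.pts :=
  rfl

/-- The translated configuration. -/
def translate (v : Plane) (φ : Config) : Config :=
  ⟨(fun x => x + v) '' φ.pts, fun r => by
    refine ((φ.finite_inter_of_isBounded (B := (fun x => x + v) ⁻¹' Metric.closedBall 0 r)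
      ?_).image (fun x => x + v)).subset ?_
    · have : (fun x => x + v) ⁻¹' Metric.closedBall 0 r = Metric.closedBall (-v) r := by
        ext x; simp [dist_eq_norm]
      rw [this]; exact Metric.isBounded_closedBall
    · rintro _ ⟨⟨x, hx, rfl⟩, h⟩
      exact ⟨x, ⟨hx, h⟩, rfl⟩⟩

theorem translate_pts (v : Plane) (φ : Config) :
    (translate v φ).pts = (fun x => x + v) '' φ.pts := rfl

theorem mem_translate_pts {v x : Plane} {φ : Config} :
    x ∈ (translate v φ).pts ↔ x - v ∈ φ.pts := by
  rw [translate_pts]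
  exact ⟨by rintro ⟨y, hy, rfl⟩; simpa using hy, fun h => ⟨x - v, h, by simp⟩⟩

theorem translate_insert (v x : Plane) (φ : Config) :
    translate v (insert x φ) = insert (x + v) (translate v φ) :=
  Subtype.ext (Set.image_insert_eq)

theorem count_translate (v : Plane) (φ : Config) (B : Set Plane) :
    (translate v φ).count B = φ.count ((fun x => x + v) ⁻¹' B) := by
  rw [count, count, translate_pts, ← Set.image_inter_preimage]
  exact (add_left_injective v).encard_image _

theorem measurable_translate (v : Plane) : Measurable (translate v) :=
  measurable_of_count fun B hB => by
    simp only [count_translate]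
    exact measurable_count ((measurable_add_const v) hB)

-- Removing `x` from `B` keeps the formula correct when `x` already belongs to the configuration.
open Classical in
theorem count_insert (x : Plane) (φ : Config) (B : Set Plane) :
    (insert x φ).count B = (if x ∈ B then 1 else 0) + φ.count (B \ {x}) := by
  simp only [count, insert_pts]
  split_ifs with h
  · have : Insert.insert x φ.pts ∩ B = Insert.insert x (φ.pts ∩ (B \ {x})) := by
      ext y; by_cases hy : y = x <;> simp [hy, h]
    rw [this, Set.encard_insert_of_notMem (by simp), add_comm]
  · have : Insert.insert x φ.pts ∩ B = φ.pts ∩ (B \ {x}) := by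
      ext y; by_cases hy : y = x <;> simp [hy, h]
    rw [this, zero_add]

theorem measurable_insert : Measurable fun p : Plane × Config => insert p.1 p.2 := by
  classical
  refine measurable_of_count fun B hB => measurable_enat_of_toENNReal ?_
  have hs : MeasurableSet {q : (Plane × Config) × Plane | q.2 ∈ B ∧ q.2 ≠ q.1.1} :=
    (measurable_snd hB).inter
      (measurableSet_eq_fun measurable_snd (measurable_fst.comp measurable_fst)).compl
  have h : ∀ p : Plane × Config, ((insert p.1 p.2).count B : ℝ≥0∞) =
      (if p.1 ∈ B then 1 else 0) +
        ∫⁻ y, Set.indicator {q : (Plane × Config) × Plane | q.2 ∈ B ∧ q.2 ≠ q.1.1} 1 (p, y)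
          ∂(pointKernel p.2) := by
    rintro ⟨x, φ⟩
    rw [count_insert, ENat.toENNReal_add, ← pointMeasure_apply φ (hB.diff
      (measurableSet_singleton x)), ← lintegral_indicator_one (hB.diff
      (measurableSet_singleton x))]
    congr 1
    split_ifs <;> simp
  simp only [h]
  exact (Measurable.ite (measurable_fst hB) measurable_const measurable_const).add
    (measurable_lintegral_pointKernel measurable_snd (measurable_one.indicator hs))

/-- The event that a configuration has no point in `B`. -/
def void (B : Set Plane) : Set Config := {φ | φ.count B = 0}

theorem mem_void {B : Set Plane} {φ : Config} : φ ∈ void B ↔ ∀ x ∈ φ.pts, x ∉ B := by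
  rw [void, Set.mem_ofPred_eq, count, Set.encard_eq_zero, Set.eq_empty_iff_forall_notMem]
  exact forall_congr' fun x => by simp [not_and]

theorem measurableSet_void {B : Set Plane} (hB : MeasurableSet B) : MeasurableSet (void B) :=
  measurable_count hB (measurableSet_singleton 0)

theorem void_inter_void (A B : Set Plane) : void A ∩ void B = void (A ∪ B) := by
  ext φ
  simp only [Set.mem_inter_iff, mem_void, Set.mem_union, not_or]
  exact ⟨fun h x hx => ⟨h.1 x hx, h.2 x hx⟩, fun h => ⟨fun x hx => (h x hx).1,
    fun x hx => (h x hx).2⟩⟩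

theorem void_empty : void ∅ = Set.univ := by
  ext φ; simp [mem_void]

theorem void_iUnion {ι : Type*} (B : ι → Set Plane) : void (⋃ i, B i) = ⋂ i, void (B i) := by
  ext φ
  simp only [Set.mem_iInter, mem_void, Set.mem_iUnion, not_exists]
  exact ⟨fun h i x hx => h x hx i, fun h x hx i => h i x hx⟩

/-- The void events of the Borel regions of finite area. -/
def voidEvents : Set (Set Config) :=
  {D | ∃ B : Set Plane, MeasurableSet B ∧ volume B ≠ ∞ ∧ void B = D}

theorem isPiSystem_voidEvents : IsPiSystem voidEvents := by
  rintro _ ⟨A, hA, hA', rfl⟩ _ ⟨B, hB, hB', rfl⟩ -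
  exact ⟨A ∪ B, hA.union hB, (measure_union_lt_top hA'.lt_top hB'.lt_top).ne,
    (void_inter_void A B).symm⟩

theorem univ_mem_voidEvents : Set.univ ∈ voidEvents :=
  ⟨∅, .empty, by simp, void_empty⟩

-- Finitely many points of a Hausdorff space are separated by disjoint basic open sets. Since the
-- basis is countable, this expresses counts through void events by countable operations.
open TopologicalSpace in
theorem le_count_iff (φ : Config) (B : Set Plane) (n : ℕ) :
    (n : ℕ∞) ≤ φ.count B ↔ ∃ U : Fin n → countableBasis Plane,
      Pairwise (Function.onFun Disjoint fun i => (U i : Set Plane)) ∧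
        ∀ i, φ ∉ void (B ∩ U i) := by
  constructor
  · intro h
    obtain ⟨t, ht, htn⟩ := Set.exists_subset_encard_eq h
    have htf : t.Finite := Set.finite_of_encard_eq_coe htn
    obtain ⟨V, hV, hVd⟩ := htf.t2_separation
    have hcard : Nat.card t = n := by
      rw [Nat.card_coe_set_eq, Set.ncard, htn]; rfl
    have := htf.to_subtype
    let e : Fin n ≃ t := (Finite.equivFinOfCardEq hcard).symm
    have hU : ∀ i : Fin n, ∃ U : countableBasis Plane, (e i : Plane) ∈ (U : Set Plane) ∧
        (U : Set Plane) ⊆ V (e i) := fun i => by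
      obtain ⟨U, hU, hxU, hUV⟩ := (isBasis_countableBasis Plane).exists_subset_of_mem_open
        (hV (e i)).1 (hV (e i)).2
      exact ⟨⟨U, hU⟩, hxU, hUV⟩
    choose U hxU hUV using hU
    refine ⟨U, fun i j hij => ?_, fun i hi => ?_⟩
    · exact (hVd (e i).2 (e j).2 fun h => hij (e.injective (Subtype.ext h))).mono (hUV i) (hUV j)
    · exact mem_void.1 hi (e i) (ht (e i).2).1 ⟨(ht (e i).2).2, hxU i⟩
  · rintro ⟨U, hUd, hU⟩
    have hx : ∀ i, ∃ x ∈ φ.pts, x ∈ B ∩ U i := fun i => by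
      have := hU i
      rw [mem_void] at this
      push Not at this
      exact this
    choose x hx hxU using hx
    have hinj : Function.Injective x := fun i j hij => by
      by_contra h
      exact Set.disjoint_left.1 (hUd h) (hxU i).2 (hij ▸ (hxU j).2)
    calc (n : ℕ∞) = (Set.range x).encard := by
          rw [← Set.image_univ, hinj.encard_image, Set.encard_univ]; simp
      _ ≤ φ.count B := Set.encard_le_encard (by rintro _ ⟨i, rfl⟩; exact ⟨hx i, (hxU i).1⟩)

open TopologicalSpace in
theorem generateFrom_voidEvents :
    instMeasurableSpace = MeasurableSpace.generateFrom voidEvents := by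
  apply le_antisymm
  · have hvoid : ∀ B, MeasurableSet B →
        MeasurableSet[MeasurableSpace.generateFrom voidEvents] (void B) := fun B hB => by
      -- Void events of regions of infinite area are countable intersections of those of bounded
      -- pieces.
      have : B = ⋃ n : ℕ, B ∩ Metric.closedBall 0 n := by
        rw [← Set.inter_iUnion, Metric.iUnion_closedBall_nat, Set.inter_univ]
      rw [this, void_iUnion]
      exact .iInter fun n => MeasurableSpace.measurableSet_generateFrom
        ⟨_, hB.inter measurableSet_closedBall,
          ((measure_mono Set.inter_subset_right).trans_lt measure_closedBall_lt_top).ne, rfl⟩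
    refine iSup₂_le fun B hB => measurable_iff_comap_le.1 ?_
    have hle : ∀ n : ℕ, MeasurableSet[MeasurableSpace.generateFrom voidEvents]
        {φ : Config | (n : ℕ∞) ≤ φ.count B} := fun n => by
      simp only [le_count_iff, Set.ofPred_exists, Set.ofPred_and, Set.ofPred_forall]
      have : Countable (countableBasis Plane) := (countable_countableBasis Plane).to_subtype
      refine .iUnion fun U => (MeasurableSet.const _).inter (.iInter fun i => ?_)
      exact (hvoid _ (hB.inter
        ((isBasis_countableBasis Plane).isOpen (U i).2).measurableSet)).compl
    refine @measurable_to_countable' ℕ∞ Config _ _ (MeasurableSpace.generateFrom voidEvents) _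
      fun m => ?_
    induction m using ENat.recTopCoe with
    | top =>
      have : (fun φ : Config => φ.count B) ⁻¹' {⊤} =
          ⋂ n : ℕ, {φ : Config | (n : ℕ∞) ≤ φ.count B} := by
        ext φ
        simp only [Set.mem_preimage, Set.mem_singleton_iff, Set.mem_iInter, Set.mem_ofPred_eq]
        exact ENat.eq_top_iff_forall_ge
      rw [this]
      exact .iInter hle
    | coe n =>
      have : (fun φ : Config => φ.count B) ⁻¹' {(n : ℕ∞)} =
          {φ : Config | (n : ℕ∞) ≤ φ.count B} \ {φ : Config | ((n + 1 : ℕ) : ℕ∞) ≤ φ.count B} := by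
        ext φ
        simp only [Set.mem_preimage, Set.mem_singleton_iff, Set.mem_sdiff, Set.mem_ofPred_eq]
        rw [Nat.cast_add, Nat.cast_one, ENat.add_one_le_iff (ENat.natCast_ne_top n), not_lt,
          le_antisymm_iff, and_comm]
      rw [this]
      exact (hle n).diff (hle (n + 1))
  · refine MeasurableSpace.generateFrom_le ?_
    rintro _ ⟨B, hB, -, rfl⟩
    exact measurableSet_void hB

/-- A law on configurations is determined by its void probabilities. -/
theorem measure_ext_of_void {μ ν : Measure Config} [IsFiniteMeasure μ]
    (h : ∀ B, MeasurableSet B → volume B ≠ ∞ → μ (void B) = ν (void B)) : μ = ν := by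
  refine ext_of_generate_finite _ generateFrom_voidEvents isPiSystem_voidEvents ?_ ?_
  · rintro _ ⟨B, hB, hB', rfl⟩; exact h B hB hB'
  · rw [← void_empty]; exact h ∅ .empty (by simp)

end Config

/-! ### Poisson processes: mean counts, stationarity, Mecke formula -/

theorem lintegral_natCast_poissonMeasure (r : ℝ≥0) :
    ∫⁻ n : ℕ, (n : ℝ≥0∞) ∂(poissonMeasure r) = r := by
  rw [lintegral_countable', tsum_eq_zero_add' ENNReal.summable]
  -- The identity $(n+1)\,p_{n+1}=r\,p_n$ reduces the mean to the total mass.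
  have h : ∀ n : ℕ, ((n + 1 : ℕ) : ℝ≥0∞) * poissonMeasure r {n + 1} =
      r * poissonMeasure r {n} := fun n => by
    rw [poissonMeasure_singleton, poissonMeasure_singleton, ← ENNReal.ofReal_natCast,
      ← ENNReal.ofReal_coe_nnreal, ← ENNReal.ofReal_mul (by positivity),
      ← ENNReal.ofReal_mul (by positivity)]
    congr 1
    rw [Nat.factorial_succ]
    push_cast
    field_simp
    ring
  simp only [h, ENNReal.tsum_mul_left, Nat.cast_zero, zero_mul, zero_add]
  have : ∑' n : ℕ, poissonMeasure r {n} = 1 := by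
    have := lintegral_countable' (μ := poissonMeasure r) (fun _ => (1 : ℝ≥0∞))
    simpa using this.symm
  rw [this, mul_one]

/-- A random variable in `ℕ ∪ {∞}` with the finite point masses of a probability measure on `ℕ`
has that measure as its law. -/
theorem map_eq_map_natCast {Ω : Type*} [MeasurableSpace Ω] {P : Measure Ω} [IsProbabilityMeasure P]
    {N : Ω → ℕ∞} (hN : Measurable N) {μ : Measure ℕ} [IsProbabilityMeasure μ]
    (h : ∀ n : ℕ, P {ω | N ω = n} = μ {n}) : P.map N = μ.map (fun n : ℕ => (n : ℕ∞)) := by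
  have : IsProbabilityMeasure (P.map N) := Measure.isProbabilityMeasure_map hN.aemeasurable
  have : IsProbabilityMeasure (μ.map (fun n : ℕ => (n : ℕ∞))) :=
    Measure.isProbabilityMeasure_map Measurable.of_discrete.aemeasurable
  have hn : ∀ n : ℕ, P.map N {(n : ℕ∞)} = μ.map (fun n : ℕ => (n : ℕ∞)) {(n : ℕ∞)} := fun n => by
    rw [Measure.map_apply hN (measurableSet_singleton _),
      Measure.map_apply .of_discrete (measurableSet_singleton _)]
    refine (h n).trans ?_
    congr 1
    ext m; simp
  refine Measure.ext_of_singleton fun m => ?_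
  induction m using ENat.recTopCoe with
  | coe n => exact hn n
  | top =>
    -- The mass at infinity is forced, both laws being probability measures.
    have ht : ({⊤} : Set ℕ∞) = (⋃ n : ℕ, {(n : ℕ∞)})ᶜ := by
      ext m
      induction m using ENat.recTopCoe <;> simp
    have hd : Pairwise (Function.onFun Disjoint fun n : ℕ => ({(n : ℕ∞)} : Set ℕ∞)) :=
      fun i j hij => by simpa [Function.onFun] using hij
    rw [ht, prob_compl_eq_one_sub .of_discrete, prob_compl_eq_one_sub .of_discrete,
      measure_iUnion hd fun _ => .of_discrete, measure_iUnion hd fun _ => .of_discrete]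
    simp only [hn]

namespace IsPoissonProcess

variable {Ω : Type*} [MeasurableSpace Ω] {P : Measure Ω} {Pi : Ω → Config} {lam : ℝ≥0}

theorem map_void (h : IsPoissonProcess P Pi lam) {B : Set Plane} (hB : MeasurableSet B)
    (hB' : volume B ≠ ∞) :
    P.map Pi (Config.void B) = ENNReal.ofReal (Real.exp (-(lam * (volume B).toReal))) := by
  rw [Measure.map_apply h.measurable (Config.measurableSet_void hB)]
  refine (h.law B hB hB' 0).trans ?_
  rw [poissonMeasure_singleton]
  simp [ENNReal.coe_toNNReal_eq_toReal]

theorem mean_count [IsProbabilityMeasure P] (h : IsPoissonProcess P Pi lam) {B : Set Plane}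
    (hB : MeasurableSet B) (hB' : volume B ≠ ∞) :
    mean P (fun ω => (Pi ω).count B) = lam * volume B := by
  have hm : Measurable fun ω => (Pi ω).count B := (Config.measurable_count hB).comp h.measurable
  rw [mean, ← lintegral_map measurable_enat_toENNReal hm,
    map_eq_map_natCast hm (h.law B hB hB'),
    lintegral_map measurable_enat_toENNReal .of_discrete]
  simp only [ENat.toENNReal_coe]
  rw [lintegral_natCast_poissonMeasure]
  simp [ENNReal.coe_toNNReal hB']

theorem isProbabilityMeasure_map [IsProbabilityMeasure P] (h : IsPoissonProcess P Pi lam) :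
    IsProbabilityMeasure (P.map Pi) :=
  Measure.isProbabilityMeasure_map h.measurable.aemeasurable

theorem map_translate [IsProbabilityMeasure P] (h : IsPoissonProcess P Pi lam) (v : Plane) :
    (P.map Pi).map (Config.translate v) = P.map Pi := by
  have := h.isProbabilityMeasure_map
  have := Measure.isProbabilityMeasure_map (μ := P.map Pi)
    (Config.measurable_translate v).aemeasurable
  refine Config.measure_ext_of_void fun B hB hB' => ?_
  have hv : Config.translate v ⁻¹' Config.void B = Config.void ((fun x => x + v) ⁻¹' B) := by
    ext φ
    simp only [Config.void, Set.mem_preimage, Set.mem_ofPred_eq, Config.count_translate]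
  have hvol : volume ((fun x => x + v) ⁻¹' B) = volume B := measure_preimage_add_right _ _ _
  rw [Measure.map_apply (Config.measurable_translate v) (Config.measurableSet_void hB), hv,
    h.map_void ((measurable_add_const v) hB) (by rwa [hvol]), hvol, h.map_void hB hB']

/-- When `B` is empty of points, those in `A` lie in `A \ B`, and the counts in `A \ B` and in `B`
are independent. This is the Mecke formula for the product of a void event and a region. -/
theorem setLIntegral_void_count [IsProbabilityMeasure P] (h : IsPoissonProcess P Pi lam)
    {A B : Set Plane} (hA : MeasurableSet A) (hA' : volume A ≠ ∞) (hB : MeasurableSet B) :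
    ∫⁻ φ in Config.void B, (φ.count A : ℝ≥0∞) ∂(P.map Pi) =
      lam * volume (A \ B) * P.map Pi (Config.void B) := by
  have hAB : MeasurableSet (A \ B) := hA.diff hB
  have hAB' : volume (A \ B) ≠ ∞ := ((measure_mono Set.sdiff_subset).trans_lt hA'.lt_top).ne
  have hc : ∀ φ ∈ Config.void B, (φ.count A : ℝ≥0∞) = (φ.count (A \ B) : ℝ≥0∞) := fun φ hφ => by
    have : φ.pts ∩ A = φ.pts ∩ (A \ B) := by
      ext x
      simp only [Set.mem_inter_iff, Set.mem_sdiff]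
      exact ⟨fun hx => ⟨hx.1, hx.2, Config.mem_void.1 hφ x hx.1⟩, fun hx => ⟨hx.1, hx.2.1⟩⟩
    rw [Config.count, this, Config.count]
  have hV := Config.measurableSet_void hB
  have hm : Measurable fun φ : Config => (φ.count (A \ B) : ℝ≥0∞) :=
    measurable_enat_toENNReal.comp (Config.measurable_count hAB)
  have hind : IndepFun (fun ω => (Pi ω).count (A \ B)) (fun ω => (Pi ω).count B) P := by
    have := (h.indep 2 ![A \ B, B] (by simp [Fin.forall_fin_two, hAB, hB]) (by
      intro i j hij
      fin_cases i <;> fin_cases j <;>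
        simp_all [Function.onFun, Set.disjoint_sdiff_left, Set.disjoint_sdiff_right])).indepFun
      (i := 0) (j := 1) (by simp)
    simpa using this
  rw [setLIntegral_congr_fun hV hc, ← lintegral_indicator hV,
    lintegral_map (hm.indicator hV) h.measurable]
  have hi : ∀ ω, (Config.void B).indicator (fun φ => (φ.count (A \ B) : ℝ≥0∞)) (Pi ω) =
      ((Pi ω).count (A \ B) : ℝ≥0∞) * ({0} : Set ℕ∞).indicator 1 ((Pi ω).count B) := fun ω => by
    by_cases h0 : (Pi ω).count B = 0 <;> simp [Set.indicator, Config.void, h0]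
  have hI : Measurable (({0} : Set ℕ∞).indicator (1 : ℕ∞ → ℝ≥0∞)) := .of_discrete
  simp only [hi]
  refine (lintegral_mul_eq_lintegral_mul_lintegral_of_indepFun (hm.comp h.measurable)
    (hI.comp ((Config.measurable_count hB).comp h.measurable))
    (hind.comp measurable_enat_toENNReal hI)).trans ?_
  congr 1
  · exact h.mean_count hAB hAB'
  · rw [Measure.map_apply h.measurable hV, ← lintegral_indicator_one (h.measurable hV)]
    rfl

/-- The Mecke formula. -/
theorem lintegral_pointKernel [IsProbabilityMeasure P] (h : IsPoissonProcess P Pi lam)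
    {f : Config × Plane → ℝ≥0∞} (hf : Measurable f) :
    ∫⁻ φ, ∫⁻ x, f (φ, x) ∂(Config.pointKernel φ) ∂(P.map Pi) =
      lam * ∫⁻ x, ∫⁻ φ, f (φ.insert x, x) ∂(P.map Pi) := by
  have := h.isProbabilityMeasure_map
  set Q := P.map Pi
  have hins : Measurable fun p : Plane × Config => (Config.insert p.1 p.2, p.1) :=
    Config.measurable_insert.prodMk measurable_fst
  -- The formula as an equality of measures: on the left the Campbell measure, on the right the
  -- image of Lebesgue measure times the law under insertion of the point.
  have key : Q ⊗ₘ Config.pointKernel = (lam • (volume : Measure Plane).prod Q).map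
      fun p : Plane × Config => (Config.insert p.1 p.2, p.1) := by
    let C : Set (Set Plane) := {A | MeasurableSet A ∧ volume A ≠ ∞}
    have hball : ∀ n : ℕ, Metric.closedBall (0 : Plane) n ∈ C := fun n =>
      ⟨measurableSet_closedBall, measure_closedBall_lt_top.ne⟩
    have hCspan : IsCountablySpanning C :=
      ⟨fun n : ℕ => Metric.closedBall 0 n, hball, Metric.iUnion_closedBall_nat 0⟩
    have hDspan : IsCountablySpanning Config.voidEvents :=
      ⟨fun _ => Set.univ, fun _ => Config.univ_mem_voidEvents, Set.iUnion_const _⟩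
    have hCpi : IsPiSystem C := fun A hA B hB _ => ⟨hA.1.inter hB.1,
      ((measure_mono Set.inter_subset_left).trans_lt hA.2.lt_top).ne⟩
    have hCgen : MeasurableSpace.generateFrom C = (inferInstance : MeasurableSpace Plane) := by
      refine le_antisymm (MeasurableSpace.generateFrom_le fun A hA => hA.1) fun A hA => ?_
      have : A = ⋃ n : ℕ, A ∩ Metric.closedBall 0 n := by
        rw [← Set.inter_iUnion, Metric.iUnion_closedBall_nat, Set.inter_univ]
      rw [this]
      exact .iUnion fun n => MeasurableSpace.measurableSet_generateFrom
        ⟨hA.inter measurableSet_closedBall,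
          ((measure_mono Set.inter_subset_right).trans_lt measure_closedBall_lt_top).ne⟩
    have hbox : ∀ A ∈ C, ∀ B, MeasurableSet B → volume B ≠ ∞ →
        (Q ⊗ₘ Config.pointKernel) (Config.void B ×ˢ A) =
          lam * volume (A \ B) * Q (Config.void B) := fun A hA B hB _ => by
      rw [Measure.compProd_apply_prod (Config.measurableSet_void hB) hA.1]
      simp only [Config.pointKernel_apply' _ hA.1]
      exact h.setLIntegral_void_count hA.1 hA.2 hB
    refine Measure.ext_of_generateFrom_of_iUnion _ (fun n : ℕ => Set.univ ×ˢ Metric.closedBall 0 n)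
      (generateFrom_eq_prod Config.generateFrom_voidEvents.symm hCgen hDspan hCspan).symm
      (Config.isPiSystem_voidEvents.prod hCpi) ?_ (fun n => ⟨_, Config.univ_mem_voidEvents, _,
        hball n, rfl⟩) (fun n => ?_) ?_
    · rw [← Set.prod_iUnion, Metric.iUnion_closedBall_nat, Set.univ_prod_univ]
    · rw [← Config.void_empty, hbox _ (hball n) ∅ .empty (by simp)]
      exact ENNReal.mul_ne_top (ENNReal.mul_ne_top ENNReal.coe_ne_top
        (by simpa using (hball n).2)) (measure_ne_top _ _)
    · rintro _ ⟨_, ⟨B, hB, hB', rfl⟩, A, hA, rfl⟩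
      rw [hbox A hA B hB hB', Measure.map_apply hins ((Config.measurableSet_void hB).prod hA.1)]
      -- After insertion of `x` the region `B` is empty exactly when it was empty before and `x` is
      -- outside it; this produces the same `A \ B` as on the left.
      have hpre : (fun p : Plane × Config => (Config.insert p.1 p.2, p.1)) ⁻¹'
          (Config.void B ×ˢ A) = (A \ B) ×ˢ Config.void B := by
        ext ⟨x, φ⟩
        simp only [Set.mem_preimage, Set.mem_prod, Config.mem_void, Config.insert_pts,
          Set.forall_mem_insert, Set.mem_sdiff]
        tauto
      rw [hpre, Measure.smul_apply, Measure.prod_prod, mul_assoc]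
      rfl
  rw [← Measure.lintegral_compProd hf, key, lintegral_map hf hins, lintegral_smul_measure,
    lintegral_prod (fun p : Plane × Config => f (Config.insert p.1 p.2, p.1))
      (hf.comp hins).aemeasurable]
  rfl

end IsPoissonProcess

/-! ### The pair of independent processes and Palm averages -/

section Joint

variable {Ω : Type*} [MeasurableSpace Ω] {P : Measure Ω} [IsProbabilityMeasure P]
  {PiL PiE : Ω → Config} {lamL lamE : ℝ≥0}

theorem map_prodMk_eq (hPiL : IsPoissonProcess P PiL lamL) (hPiE : IsPoissonProcess P PiE lamE)
    (hindep : IndepFun PiL PiE P) :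
    P.map (fun ω => (PiL ω, PiE ω)) = (P.map PiL).prod (P.map PiE) :=
  (indepFun_iff_map_prod_eq_prod_map_map hPiL.measurable.aemeasurable
    hPiE.measurable.aemeasurable).1 hindep

theorem lintegral_joint (hPiL : IsPoissonProcess P PiL lamL) (hPiE : IsPoissonProcess P PiE lamE)
    (hindep : IndepFun PiL PiE P) {F : Config × Config → ℝ≥0∞} (hF : Measurable F) :
    ∫⁻ ω, F (PiL ω, PiE ω) ∂P = ∫⁻ ψ, ∫⁻ φ, F (φ, ψ) ∂(P.map PiL) ∂(P.map PiE) := by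
  have := hPiL.isProbabilityMeasure_map
  have := hPiE.isProbabilityMeasure_map
  rw [← lintegral_map hF (hPiL.measurable.prodMk hPiE.measurable),
    map_prodMk_eq hPiL hPiE hindep, lintegral_prod_symm' _ hF]

/-- Independence allows the eavesdroppers to be frozen while the Mecke formula is applied to the
nodes alone. -/
theorem lintegral_joint_pointKernel (hPiL : IsPoissonProcess P PiL lamL)
    (hPiE : IsPoissonProcess P PiE lamE) (hindep : IndepFun PiL PiE P)
    {f : Plane × Config × Config → ℝ≥0∞} (hf : Measurable f) :
    ∫⁻ ω, ∫⁻ x, f (x, PiL ω, PiE ω) ∂(Config.pointKernel (PiL ω)) ∂P =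
      lamL * ∫⁻ x, ∫⁻ ω, f (x, (PiL ω).insert x, PiE ω) ∂P := by
  have := hPiL.isProbabilityMeasure_map
  have := hPiE.isProbabilityMeasure_map
  have h1 : Measurable fun p : Config × Config => ∫⁻ x, f (x, p) ∂(Config.pointKernel p.1) :=
    Config.measurable_lintegral_pointKernel (f := fun q : (Config × Config) × Plane => f (q.2, q.1))
      measurable_fst (hf.comp measurable_swap)
  have h2 : Measurable fun t : Plane × Config × Config => f (t.1, t.2.1.insert t.1, t.2.2) :=
    hf.comp (measurable_fst.prodMk ((Config.measurable_insert.comp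
      (measurable_fst.prodMk (measurable_fst.comp measurable_snd))).prodMk
      (measurable_snd.comp measurable_snd)))
  rw [lintegral_joint hPiL hPiE hindep h1]
  have h3 : ∀ ψ, ∫⁻ φ, ∫⁻ x, f (x, φ, ψ) ∂(Config.pointKernel φ) ∂(P.map PiL) =
      lamL * ∫⁻ x, ∫⁻ φ, f (x, φ.insert x, ψ) ∂(P.map PiL) := fun ψ =>
    hPiL.lintegral_pointKernel (f := fun p => f (p.2, p.1, ψ)) (hf.comp
      (measurable_snd.prodMk (measurable_fst.prodMk measurable_const)))
  have h4 : ∀ x, ∫⁻ ω, f (x, (PiL ω).insert x, PiE ω) ∂P =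
      ∫⁻ ψ, ∫⁻ φ, f (x, φ.insert x, ψ) ∂(P.map PiL) ∂(P.map PiE) := fun x =>
    lintegral_joint hPiL hPiE hindep (F := fun p => f (x, p.1.insert x, p.2))
      (h2.comp measurable_prodMk_left)
  have h5 : Measurable fun q : Config × Plane => ∫⁻ φ, f (q.2, φ.insert q.2, q.1) ∂(P.map PiL) :=
    Measurable.lintegral_prod_right' (f := fun r : (Config × Plane) × Config =>
      f (r.1.2, r.2.insert r.1.2, r.1.1)) (h2.comp ((measurable_snd.comp measurable_fst).prodMk
        (measurable_snd.prodMk (measurable_fst.comp measurable_fst))))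
  simp only [h3, h4]
  rw [lintegral_const_mul _ h5.lintegral_prod_right', lintegral_lintegral_swap h5.aemeasurable]

theorem lintegral_joint_translate (hPiL : IsPoissonProcess P PiL lamL)
    (hPiE : IsPoissonProcess P PiE lamE) (hindep : IndepFun PiL PiE P)
    {F : Config × Config → ℝ≥0∞} (hF : Measurable F) (v : Plane) :
    ∫⁻ ω, F ((PiL ω).translate v, (PiE ω).translate v) ∂P = ∫⁻ ω, F (PiL ω, PiE ω) ∂P := by
  have := hPiL.isProbabilityMeasure_map
  have := hPiE.isProbabilityMeasure_map
  have ht := Config.measurable_translate v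
  have hm := hPiL.measurable.prodMk hPiE.measurable
  have h1 := lintegral_map (μ := P) (hF.comp (ht.prodMap ht)) hm
  have h2 := lintegral_map (μ := (P.map PiL).prod (P.map PiE)) hF (ht.prodMap ht)
  rw [← Measure.map_prod_map _ _ ht ht, hPiL.map_translate, hPiE.map_translate,
    ← map_prodMk_eq hPiL hPiE hindep, lintegral_map hF hm] at h2
  exact (h2.trans h1).symm

/-- The Palm average of a translation-equivariant quantity is its mean at an added point. -/
theorem palmMean_eq_mean (hPiL : IsPoissonProcess P PiL lamL) (hPiE : IsPoissonProcess P PiE lamE)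
    (hindep : IndepFun PiL PiE P) (hL : 0 < lamL) {D : Plane → Config → Config → ℕ∞}
    (hD : Measurable fun t : Plane × Config × Config => (D t.1 t.2.1 t.2.2 : ℝ≥0∞))
    (hDt : ∀ v x φ ψ, D (x + v) (φ.translate v) (ψ.translate v) = D x φ ψ)
    {W : Set Plane} (hW : MeasurableSet W) (hW0 : volume W ≠ 0) (hW1 : volume W ≠ ∞) :
    palmMean P PiL W (fun ω x => D x (PiL ω) (PiE ω)) =
      mean P (fun ω => D 0 ((PiL ω).insert 0) (PiE ω)) := by
  have h1 : ∀ ω, ∑' x : ↑((PiL ω).pts ∩ W), (D x (PiL ω) (PiE ω) : ℝ≥0∞) =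
      ∫⁻ x, W.indicator (fun x => (D x (PiL ω) (PiE ω) : ℝ≥0∞)) x
        ∂(Config.pointKernel (PiL ω)) := fun ω => by
    rw [Config.lintegral_pointKernel,
      tsum_subtype (PiL ω).pts (W.indicator fun x => (D x (PiL ω) (PiE ω) : ℝ≥0∞)),
      tsum_subtype ((PiL ω).pts ∩ W) (fun x => (D x (PiL ω) (PiE ω) : ℝ≥0∞)),
      Set.indicator_indicator]
  have h2 : ∀ x, ∫⁻ ω, (D x ((PiL ω).insert x) (PiE ω) : ℝ≥0∞) ∂P =
      mean P (fun ω => D 0 ((PiL ω).insert 0) (PiE ω)) := fun x => by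
    have hx : Measurable fun p : Config × Config => (D x (p.1.insert x) p.2 : ℝ≥0∞) :=
      hD.comp (measurable_const.prodMk
        ((Config.measurable_insert.comp (measurable_const.prodMk measurable_fst)).prodMk
          measurable_snd))
    rw [mean, ← lintegral_joint_translate hPiL hPiE hindep hx x]
    refine lintegral_congr fun ω => ?_
    have := hDt x 0 ((PiL ω).insert 0) (PiE ω)
    rw [Config.translate_insert, zero_add] at this
    rw [this]
  have h3 := lintegral_joint_pointKernel hPiL hPiE hindep
    (f := fun t => W.indicator (fun x => (D x t.2.1 t.2.2 : ℝ≥0∞)) t.1)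
    (by
      have := hD.indicator (measurable_fst hW (β := Config × Config))
      convert this using 1
      ext t
      by_cases ht : t.1 ∈ W <;> simp [ht])
  have h4 : ∀ x, ∫⁻ ω, W.indicator (fun y => (D y ((PiL ω).insert x) (PiE ω) : ℝ≥0∞)) x ∂P =
      W.indicator (fun _ => mean P (fun ω => D 0 ((PiL ω).insert 0) (PiE ω))) x := fun x => by
    by_cases hx : x ∈ W <;> simp [hx, h2]
  rw [palmMean, hPiL.mean_count hW hW1]
  simp only [h1]
  rw [h3]
  simp only [h4]
  rw [lintegral_indicator_const hW, mul_comm (mean P _), ← mul_assoc, mul_comm]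
  exact ENNReal.mul_div_cancel_right (mul_ne_zero (by simpa using hL.ne') hW0)
    (ENNReal.mul_ne_top ENNReal.coe_ne_top hW1)

end Joint

/-! ### Edges and degrees: measurability and translation equivariance -/

section Degrees

theorem mem_neutralizationRegion {nodes : Set Plane} {ρ : ℝ} {e : Plane} :
    e ∈ neutralizationRegion nodes ρ ↔ ∃ z ∈ nodes, dist e z ≤ ρ := by
  simp [neutralizationRegion]

theorem measurableSet_mem_pts : MeasurableSet {p : Plane × Config | p.1 ∈ p.2.pts} := by
  have := Config.measurableSet_exists_mem (measurable_snd (α := Plane) (β := Config))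
    (s := {q : (Plane × Config) × Plane | q.2 = q.1.1})
    (measurableSet_eq_fun measurable_snd (measurable_fst.comp measurable_fst))
  convert this using 1
  ext p
  simp

theorem measurableSet_mem_neutralizationRegion (ρ : ℝ) :
    MeasurableSet {p : Plane × Config | p.1 ∈ neutralizationRegion p.2.pts ρ} := by
  have := Config.measurableSet_exists_mem (measurable_snd (α := Plane) (β := Config))
    (s := {q : (Plane × Config) × Plane | dist q.1.1 q.2 ≤ ρ})
    (measurableSet_le ((measurable_fst.comp measurable_fst).dist measurable_snd) measurable_const)
  convert this using 1
  ext p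
  simp [mem_neutralizationRegion]

theorem measurableSet_adj (ρ : ℝ) :
    MeasurableSet {t : Plane × Plane × Config × Config |
      (secrecyGraph t.2.2.1.pts t.2.2.2.pts ρ).Adj t.1 t.2.1} := by
  have hx : Measurable fun t : Plane × Plane × Config × Config => t.1 := measurable_fst
  have hy : Measurable fun t : Plane × Plane × Config × Config => t.2.1 :=
    measurable_fst.comp measurable_snd
  have hφ : Measurable fun t : Plane × Plane × Config × Config => t.2.2.1 :=
    measurable_fst.comp (measurable_snd.comp measurable_snd)
  have hψ : Measurable fun t : Plane × Plane × Config × Config => t.2.2.2 :=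
    measurable_snd.comp (measurable_snd.comp measurable_snd)
  have h1 := (hx.prodMk hφ) measurableSet_mem_pts
  have h2 := (hy.prodMk hφ) measurableSet_mem_pts
  have h3 := (measurableSet_eq_fun hx hy).compl
  -- The edge condition is the complement of the existence of an unneutralized eavesdropper `e` with
  -- `dist x e ≤ dist x y`.
  have h4 := (Config.measurableSet_exists_mem hψ
    (((measurable_snd.prodMk (hφ.comp measurable_fst))
      (measurableSet_mem_neutralizationRegion ρ)).compl.inter
      (measurableSet_le ((hx.comp measurable_fst).dist measurable_snd)
        ((hx.comp measurable_fst).dist (hy.comp measurable_fst))))).compl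
  convert h1.inter (h2.inter (h3.inter h4)) using 1
  ext ⟨x, y, φ, ψ⟩
  simp only [secrecyGraph, Set.mem_ofPred_eq, Set.mem_inter_iff, Set.mem_preimage,
    Set.mem_compl_iff, not_exists, not_and, not_le, Function.comp]
  tauto

theorem adj_translate {φ ψ : Config} {ρ : ℝ} {v x y : Plane} :
    (secrecyGraph (φ.translate v).pts (ψ.translate v).pts ρ).Adj (x + v) (y + v) ↔
      (secrecyGraph φ.pts ψ.pts ρ).Adj x y := by
  have hΘ : ∀ e, e + v ∈ neutralizationRegion (φ.translate v).pts ρ ↔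
      e ∈ neutralizationRegion φ.pts ρ := fun e => by
    simp only [mem_neutralizationRegion, Config.translate_pts, Set.exists_mem_image, dist_add_right]
  have hE : (∀ e ∈ (ψ.translate v).pts ∩ (neutralizationRegion (φ.translate v).pts ρ)ᶜ,
      dist (x + v) (y + v) < dist (x + v) e) ↔
      ∀ e ∈ ψ.pts ∩ (neutralizationRegion φ.pts ρ)ᶜ, dist x y < dist x e := by
    constructor
    · rintro h e ⟨he, he'⟩
      have := h (e + v) ⟨by simpa [Config.mem_translate_pts] using he, fun h => he' ((hΘ e).1 h)⟩
      simpa using this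
    · rintro h _ ⟨⟨e, he, rfl⟩, he'⟩
      simpa using h e ⟨he, fun h => he' ((hΘ e).2 h)⟩
  simp only [secrecyGraph] at hE ⊢
  rw [hE, Config.mem_translate_pts, Config.mem_translate_pts]
  simp

theorem outDeg_translate {φ ψ : Config} {ρ : ℝ} {v x : Plane} :
    outDeg (secrecyGraph (φ.translate v).pts (ψ.translate v).pts ρ) (x + v) =
      outDeg (secrecyGraph φ.pts ψ.pts ρ) x := by
  rw [outDeg, outDeg, ← (add_left_injective v).encard_image {y | (secrecyGraph φ.pts ψ.pts ρ).Adj x y}]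
  congr 1
  ext y
  refine ⟨fun h => ⟨y - v, ?_, sub_add_cancel y v⟩, ?_⟩
  · rw [Set.mem_ofPred_eq, ← adj_translate (v := v), sub_add_cancel]
    exact h
  · rintro ⟨z, hz, rfl⟩
    exact adj_translate.2 hz

theorem inDeg_translate {φ ψ : Config} {ρ : ℝ} {v x : Plane} :
    inDeg (secrecyGraph (φ.translate v).pts (ψ.translate v).pts ρ) (x + v) =
      inDeg (secrecyGraph φ.pts ψ.pts ρ) x := by
  rw [inDeg, inDeg, ← (add_left_injective v).encard_image {y | (secrecyGraph φ.pts ψ.pts ρ).Adj y x}]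
  congr 1
  ext y
  refine ⟨fun h => ⟨y - v, ?_, sub_add_cancel y v⟩, ?_⟩
  · rw [Set.mem_ofPred_eq, ← adj_translate (v := v), sub_add_cancel]
    exact h
  · rintro ⟨z, hz, rfl⟩
    exact adj_translate.2 hz

/-- The indicator of an edge from `x` to `y`. -/
noncomputable def edge (ρ : ℝ) (x y : Plane) (φ ψ : Config) : ℝ≥0∞ :=
  Set.indicator {t : Plane × Plane × Config × Config |
    (secrecyGraph t.2.2.1.pts t.2.2.2.pts ρ).Adj t.1 t.2.1} 1 (x, y, φ, ψ)

theorem measurable_edge (ρ : ℝ) {α : Type*} [MeasurableSpace α] {x y : α → Plane}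
    {φ ψ : α → Config} (hx : Measurable x) (hy : Measurable y) (hφ : Measurable φ)
    (hψ : Measurable ψ) : Measurable fun a => edge ρ (x a) (y a) (φ a) (ψ a) :=
  (measurable_one.indicator (measurableSet_adj ρ)).comp
    (hx.prodMk (hy.prodMk (hφ.prodMk hψ)))

theorem edge_translate {φ ψ : Config} {ρ : ℝ} {v x y : Plane} :
    edge ρ (x + v) (y + v) (φ.translate v) (ψ.translate v) = edge ρ x y φ ψ := by
  classical
  simp only [edge, Set.indicator, Set.mem_ofPred_eq, adj_translate, Pi.one_apply]

/-- As there are no loops, the sum can run over `φ` without the added node, which is the form the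
Mecke formula needs. -/
theorem outDeg_insert_eq_lintegral (φ ψ : Config) (ρ : ℝ) (x : Plane) :
    (outDeg (secrecyGraph (φ.insert x).pts ψ.pts ρ) x : ℝ≥0∞) =
      ∫⁻ y, edge ρ x y (φ.insert x) ψ ∂(Config.pointKernel φ) := by
  have h : {y | (secrecyGraph (φ.insert x).pts ψ.pts ρ).Adj x y} =
      φ.pts ∩ {y | (secrecyGraph (φ.insert x).pts ψ.pts ρ).Adj x y} := by
    refine (Set.inter_eq_right.2 fun y hy => ?_).symm
    exact hy.2.1.resolve_left hy.2.2.1.symm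
  have hm : MeasurableSet {y | (secrecyGraph (φ.insert x).pts ψ.pts ρ).Adj x y} :=
    (measurable_const.prodMk (measurable_id.prodMk (measurable_const.prodMk measurable_const)))
      (measurableSet_adj ρ)
  rw [outDeg, h, ← Config.count, ← Config.pointKernel_apply' φ hm, ← lintegral_indicator_one hm]
  rfl

theorem inDeg_insert_eq_lintegral (φ ψ : Config) (ρ : ℝ) (x : Plane) :
    (inDeg (secrecyGraph (φ.insert x).pts ψ.pts ρ) x : ℝ≥0∞) =
      ∫⁻ y, edge ρ y x (φ.insert x) ψ ∂(Config.pointKernel φ) := by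
  have h : {y | (secrecyGraph (φ.insert x).pts ψ.pts ρ).Adj y x} =
      φ.pts ∩ {y | (secrecyGraph (φ.insert x).pts ψ.pts ρ).Adj y x} := by
    refine (Set.inter_eq_right.2 fun y hy => ?_).symm
    exact hy.1.resolve_left hy.2.2.1
  have hm : MeasurableSet {y | (secrecyGraph (φ.insert x).pts ψ.pts ρ).Adj y x} :=
    (measurable_id.prodMk (measurable_const.prodMk (measurable_const.prodMk measurable_const)))
      (measurableSet_adj ρ)
  rw [inDeg, h, ← Config.count, ← Config.pointKernel_apply' φ hm, ← lintegral_indicator_one hm]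
  rfl

theorem measurable_outDeg (ρ : ℝ) : Measurable fun t : Plane × Config × Config =>
    (outDeg (secrecyGraph t.2.1.pts t.2.2.pts ρ) t.1 : ℝ≥0∞) := by
  have h : ∀ t : Plane × Config × Config,
      (outDeg (secrecyGraph t.2.1.pts t.2.2.pts ρ) t.1 : ℝ≥0∞) =
        ∫⁻ y, edge ρ t.1 y t.2.1 t.2.2 ∂(Config.pointKernel t.2.1) := fun t => by
    have h : {y | (secrecyGraph t.2.1.pts t.2.2.pts ρ).Adj t.1 y} =
        t.2.1.pts ∩ {y | (secrecyGraph t.2.1.pts t.2.2.pts ρ).Adj t.1 y} :=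
      (Set.inter_eq_right.2 fun y hy => hy.2.1).symm
    have hm : MeasurableSet {y | (secrecyGraph t.2.1.pts t.2.2.pts ρ).Adj t.1 y} :=
      (measurable_const.prodMk (measurable_id.prodMk (measurable_const.prodMk measurable_const)))
        (measurableSet_adj ρ)
    rw [outDeg, h, ← Config.count, ← Config.pointKernel_apply' _ hm, ← lintegral_indicator_one hm]
    rfl
  simp only [h]
  exact Config.measurable_lintegral_pointKernel (measurable_fst.comp measurable_snd)
    (f := fun q : (Plane × Config × Config) × Plane => edge ρ q.1.1 q.2 q.1.2.1 q.1.2.2)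
    (measurable_edge ρ (by fun_prop) (by fun_prop) (by fun_prop) (by fun_prop))

theorem measurable_inDeg (ρ : ℝ) : Measurable fun t : Plane × Config × Config =>
    (inDeg (secrecyGraph t.2.1.pts t.2.2.pts ρ) t.1 : ℝ≥0∞) := by
  have h : ∀ t : Plane × Config × Config,
      (inDeg (secrecyGraph t.2.1.pts t.2.2.pts ρ) t.1 : ℝ≥0∞) =
        ∫⁻ y, edge ρ y t.1 t.2.1 t.2.2 ∂(Config.pointKernel t.2.1) := fun t => by
    have h : {y | (secrecyGraph t.2.1.pts t.2.2.pts ρ).Adj y t.1} =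
        t.2.1.pts ∩ {y | (secrecyGraph t.2.1.pts t.2.2.pts ρ).Adj y t.1} :=
      (Set.inter_eq_right.2 fun y hy => hy.1).symm
    have hm : MeasurableSet {y | (secrecyGraph t.2.1.pts t.2.2.pts ρ).Adj y t.1} :=
      (measurable_id.prodMk (measurable_const.prodMk (measurable_const.prodMk measurable_const)))
        (measurableSet_adj ρ)
    rw [inDeg, h, ← Config.count, ← Config.pointKernel_apply' _ hm, ← lintegral_indicator_one hm]
    rfl
  simp only [h]
  exact Config.measurable_lintegral_pointKernel (measurable_fst.comp measurable_snd)
    (f := fun q : (Plane × Config × Config) × Plane => edge ρ q.2 q.1.1 q.1.2.1 q.1.2.2)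
    (measurable_edge ρ (by fun_prop) (by fun_prop) (by fun_prop) (by fun_prop))

end Degrees

/-! ### Mean degrees as integrals of edge probabilities -/

section MeanDegrees

theorem Nin_eq_inDeg {Ω : Type*} (PiL PiE : Ω → Config) (ρ : ℝ) : Nin PiL PiE ρ = fun ω =>
    inDeg (secrecyGraph ((PiL ω).insert 0).pts (PiE ω).pts ρ) 0 := rfl

theorem Nout_eq_outDeg {Ω : Type*} (PiL PiE : Ω → Config) (ρ : ℝ) : Nout PiL PiE ρ = fun ω =>
    outDeg (secrecyGraph ((PiL ω).insert 0).pts (PiE ω).pts ρ) 0 := rfl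

variable {Ω : Type*} [MeasurableSpace Ω] {P : Measure Ω} [IsProbabilityMeasure P]
  {PiL PiE : Ω → Config} {lamL lamE : ℝ≥0}

theorem measurable_insert_comp (hPiL : Measurable PiL) (hPiE : Measurable PiE) (x : Plane) :
    Measurable fun ω => (x, (PiL ω).insert x, PiE ω) :=
  measurable_const.prodMk ((Config.measurable_insert.comp (measurable_const.prodMk hPiL)).prodMk
    hPiE)

theorem measurable_Nout (hPiL : Measurable PiL) (hPiE : Measurable PiE) (ρ : ℝ) :
    Measurable (Nout PiL PiE ρ) := by
  have h := (measurable_outDeg ρ).comp (measurable_insert_comp hPiL hPiE 0)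
  refine measurable_enat_of_toENNReal ?_
  rw [Nout_eq_outDeg]
  exact h

theorem measurable_Nin (hPiL : Measurable PiL) (hPiE : Measurable PiE) (ρ : ℝ) :
    Measurable (Nin PiL PiE ρ) := by
  have h := (measurable_inDeg ρ).comp (measurable_insert_comp hPiL hPiE 0)
  refine measurable_enat_of_toENNReal ?_
  rw [Nin_eq_inDeg]
  exact h

theorem measurable_insert_zero : Measurable fun φ : Config => φ.insert 0 :=
  Config.measurable_insert.comp (measurable_const.prodMk measurable_id)

theorem mean_Nout (hPiL : IsPoissonProcess P PiL lamL) (hPiE : IsPoissonProcess P PiE lamE)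
    (hindep : IndepFun PiL PiE P) (ρ : ℝ) :
    mean P (Nout PiL PiE ρ) =
      lamL * ∫⁻ y, ∫⁻ ω, edge ρ 0 y (((PiL ω).insert y).insert 0) (PiE ω) ∂P := by
  rw [mean, Nout_eq_outDeg]
  simp only [outDeg_insert_eq_lintegral]
  exact lintegral_joint_pointKernel hPiL hPiE hindep
    (f := fun t => edge ρ 0 t.1 (t.2.1.insert 0) t.2.2)
    (measurable_edge ρ (by fun_prop) (by fun_prop)
      (measurable_insert_zero.comp (by fun_prop)) (by fun_prop))

theorem mean_Nin (hPiL : IsPoissonProcess P PiL lamL) (hPiE : IsPoissonProcess P PiE lamE)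
    (hindep : IndepFun PiL PiE P) (ρ : ℝ) :
    mean P (Nin PiL PiE ρ) =
      lamL * ∫⁻ y, ∫⁻ ω, edge ρ y 0 (((PiL ω).insert y).insert 0) (PiE ω) ∂P := by
  rw [mean, Nin_eq_inDeg]
  simp only [inDeg_insert_eq_lintegral]
  exact lintegral_joint_pointKernel hPiL hPiE hindep
    (f := fun t => edge ρ t.1 0 (t.2.1.insert 0) t.2.2)
    (measurable_edge ρ (by fun_prop) (by fun_prop)
      (measurable_insert_zero.comp (by fun_prop)) (by fun_prop))

/-- Reflection turns the edge $y\to 0$ into $-y\to 0$, and translation by $y$ turns that into $0\to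
y$. The two added nodes $\{-y,0\}$ become $\{0,y\}$, and the joint law is unchanged. -/
theorem mean_Nin_eq_mean_Nout (hPiL : IsPoissonProcess P PiL lamL)
    (hPiE : IsPoissonProcess P PiE lamE) (hindep : IndepFun PiL PiE P) (ρ : ℝ) :
    mean P (Nin PiL PiE ρ) = mean P (Nout PiL PiE ρ) := by
  rw [mean_Nin hPiL hPiE hindep, mean_Nout hPiL hPiE hindep, ← lintegral_neg_eq_self]
  congr 1
  refine lintegral_congr fun y => ?_
  have hm : Measurable fun p : Config × Config =>
      edge ρ 0 y ((p.1.insert y).insert 0) p.2 :=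
    measurable_edge ρ measurable_const measurable_const (measurable_insert_zero.comp
      (Config.measurable_insert.comp (measurable_const.prodMk measurable_fst))) measurable_snd
  rw [← lintegral_joint_translate hPiL hPiE hindep hm y]
  refine lintegral_congr fun ω => ?_
  rw [← edge_translate (v := y), Config.translate_insert, Config.translate_insert,
    neg_add_cancel, zero_add]
  congr 1
  exact Subtype.ext (Set.insert_comm _ _ _)

end MeanDegrees

/-! ### Lower bound for the edge probability -/

/-- Jensen's inequality for the convex exponential; the bound `M` supplies integrability. -/
theorem ofReal_exp_neg_mul_lintegral_le {α : Type*} [MeasurableSpace α] {μ : Measure α}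
    [IsProbabilityMeasure μ] {V : α → ℝ≥0∞} (hV : Measurable V) {M : ℝ≥0∞} (hM : M ≠ ∞)
    (hVM : ∀ a, V a ≤ M) {c : ℝ} (hc : 0 ≤ c) :
    ENNReal.ofReal (Real.exp (-(c * (∫⁻ a, V a ∂μ).toReal))) ≤
      ∫⁻ a, ENNReal.ofReal (Real.exp (-(c * (V a).toReal))) ∂μ := by
  have hm : Measurable fun a => -(c * (V a).toReal) := (hV.ennreal_toReal.const_mul c).neg
  have hi : Integrable (fun a => -(c * (V a).toReal)) μ := by
    refine Integrable.of_bound hm.aestronglyMeasurable (c * M.toReal) (.of_forall fun a => ?_)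
    rw [norm_neg, Real.norm_eq_abs, abs_of_nonneg (by positivity)]
    exact mul_le_mul_of_nonneg_left (ENNReal.toReal_mono hM (hVM a)) hc
  have hi' : Integrable (fun a => Real.exp (-(c * (V a).toReal))) μ := by
    refine Integrable.of_bound (Real.measurable_exp.comp hm).aestronglyMeasurable 1
      (.of_forall fun a => ?_)
    rw [Real.norm_eq_abs, Real.abs_exp, Real.exp_le_one_iff]
    have := mul_nonneg hc (V a).toReal_nonneg
    linarith
  have h := convexOn_exp.map_integral_le Real.continuous_exp.continuousOn isClosed_univ
    (.of_forall fun _ => Set.mem_univ _) hi hi'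
  rw [← ofReal_integral_eq_lintegral_ofReal hi' (.of_forall fun a => (Real.exp_pos _).le)]
  refine ENNReal.ofReal_le_ofReal (le_trans (le_of_eq ?_) h)
  rw [integral_neg, integral_const_mul, integral_toReal hV.aemeasurable
    (.of_forall fun a => (hVM a).trans_lt hM.lt_top)]

theorem volume_annulus {ρ r : ℝ} (hρ : 0 ≤ ρ) (hr : 0 ≤ r) :
    volume (Metric.closedBall (0 : Plane) r \ Metric.closedBall 0 ρ) =
      ENNReal.ofReal (Real.pi * max 0 (r ^ 2 - ρ ^ 2)) := by
  rcases le_total r ρ with h | h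
  · rw [Set.sdiff_eq_empty.2 (Metric.closedBall_subset_closedBall h), max_eq_left]
    · simp
    · nlinarith
  · rw [measure_sdiff (Metric.closedBall_subset_closedBall h)
      measurableSet_closedBall.nullMeasurableSet measure_closedBall_lt_top.ne,
      EuclideanSpace.volume_closedBall_fin_two, EuclideanSpace.volume_closedBall_fin_two,
      ← ENNReal.ofReal_pow hr, ← ENNReal.ofReal_pow hρ, ← ENNReal.ofReal_mul (by positivity),
      ← ENNReal.ofReal_mul (by positivity), ← ENNReal.ofReal_sub _ (by positivity), max_eq_right]
    · congr 1; ring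
    · nlinarith

/-- The part of the disc of radius `‖y‖` at the origin that is not neutralized. -/
def exposedRegion (ρ : ℝ) (y : Plane) (nodes : Set Plane) : Set Plane :=
  Metric.closedBall 0 ‖y‖ ∩ (neutralizationRegion nodes ρ)ᶜ

theorem measurableSet_exposedRegion (ρ : ℝ) (y : Plane) (φ : Config) :
    MeasurableSet (exposedRegion ρ y φ.pts) :=
  measurableSet_closedBall.inter
    (((measurable_id.prodMk measurable_const) (measurableSet_mem_neutralizationRegion ρ)).compl)

/-- The strict inequality in the edge condition is why the exposed region uses a closed disc: an
eavesdropper at distance exactly `‖y‖` also blocks the edge. -/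
theorem edge_eq_indicator_void (ρ : ℝ) {y : Plane} (hy : y ≠ 0) (φ ψ : Config) :
    edge ρ 0 y ((φ.insert y).insert 0) ψ =
      (Config.void (exposedRegion ρ y ((φ.insert y).insert 0).pts)).indicator 1 ψ := by
  classical
  simp only [edge, Set.indicator, Pi.one_apply]
  congr 1
  simp only [secrecyGraph, Set.mem_ofPred_eq, Config.mem_void, exposedRegion, Set.mem_inter_iff,
    Config.insert_pts, Set.mem_insert_iff, true_or, or_true, true_and, dist_zero_left,
    Metric.mem_closedBall, dist_zero_right, eq_iff_iff, ne_eq, hy.symm, not_false_eq_true, not_and,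
    Set.mem_compl_iff, not_not, and_imp]
  refine forall_congr' fun e => forall_congr' fun _ => ?_
  rw [← not_le]
  tauto

section

variable {Ω : Type*} [MeasurableSpace Ω] {P : Measure Ω} [IsProbabilityMeasure P]
  {PiL PiE : Ω → Config} {lamL lamE : ℝ≥0}

/-- The mean area of the part of an annulus that is not neutralized. -/
theorem lintegral_volume_annulus_diff (hPiL : IsPoissonProcess P PiL lamL) {ρ r : ℝ} (hρ : 0 ≤ ρ)
    (hr : 0 ≤ r) :
    (Measurable fun φ : Config => volume ((Metric.closedBall (0 : Plane) r \
      Metric.closedBall 0 ρ) ∩ (neutralizationRegion φ.pts ρ)ᶜ)) ∧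
    ∫⁻ φ, volume ((Metric.closedBall (0 : Plane) r \ Metric.closedBall 0 ρ) ∩
      (neutralizationRegion φ.pts ρ)ᶜ) ∂(P.map PiL) =
        ENNReal.ofReal (Real.exp (-(Real.pi * lamL * ρ ^ 2)) *
          (Real.pi * max 0 (r ^ 2 - ρ ^ 2))) := by
  have := hPiL.isProbabilityMeasure_map
  set A := Metric.closedBall (0 : Plane) r \ Metric.closedBall 0 ρ with hA
  have hAm : MeasurableSet A := measurableSet_closedBall.diff measurableSet_closedBall
  have hS : MeasurableSet {p : Config × Plane | p.2 ∈ A ∧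
      p.2 ∉ neutralizationRegion p.1.pts ρ} :=
    (measurable_snd hAm).inter
      (measurable_swap (measurableSet_mem_neutralizationRegion ρ)).compl
  refine ⟨measurable_measure_prodMk_left hS, ?_⟩
  have h1 := Measure.prod_apply (μ := P.map PiL) (ν := (volume : Measure Plane)) hS
  rw [Measure.prod_apply_symm hS] at h1
  refine h1.symm.trans ?_
  -- Fubini reduces the mean area to the probability that a fixed `z` is not neutralized, that is,
  -- that no node lies in the disc of radius `ρ` about `z`.
  have h2 : ∀ z, P.map PiL ((fun φ => (φ, z)) ⁻¹' {p : Config × Plane | p.2 ∈ A ∧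
      p.2 ∉ neutralizationRegion p.1.pts ρ}) =
      A.indicator (fun _ => ENNReal.ofReal (Real.exp (-(Real.pi * lamL * ρ ^ 2)))) z := fun z => by
    by_cases hz : z ∈ A
    · have : (fun φ => (φ, z)) ⁻¹' {p : Config × Plane | p.2 ∈ A ∧
          p.2 ∉ neutralizationRegion p.1.pts ρ} = Config.void (Metric.closedBall z ρ) := by
        ext φ
        simp [hz, Config.mem_void, mem_neutralizationRegion, dist_comm]
      rw [this, hPiL.map_void measurableSet_closedBall measure_closedBall_lt_top.ne,
        Set.indicator_of_mem hz, EuclideanSpace.volume_closedBall_fin_two,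
        ENNReal.toReal_mul, ENNReal.toReal_pow, ENNReal.toReal_ofReal hρ,
        ENNReal.toReal_ofReal Real.pi_pos.le]
      congr 3
      ring
    · simp [hz]
  simp only [h2]
  rw [lintegral_indicator_const hAm, hA, volume_annulus hρ hr,
    ← ENNReal.ofReal_mul (Real.exp_pos _).le]

theorem le_lintegral_edge (hPiL : IsPoissonProcess P PiL lamL) (hPiE : IsPoissonProcess P PiE lamE)
    (hindep : IndepFun PiL PiE P) {ρ : ℝ} (hρ : 0 ≤ ρ) {y : Plane} (hy : y ≠ 0) :
    ENNReal.ofReal (Real.exp (-(lamE * (Real.exp (-(Real.pi * lamL * ρ ^ 2)) *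
        (Real.pi * max 0 (‖y‖ ^ 2 - ρ ^ 2)))))) ≤
      ∫⁻ ω, edge ρ 0 y (((PiL ω).insert y).insert 0) (PiE ω) ∂P := by
  have := hPiL.isProbabilityMeasure_map
  have := hPiE.isProbabilityMeasure_map
  have hm : Measurable fun p : Config × Config =>
      edge ρ 0 y ((p.1.insert y).insert 0) p.2 :=
    measurable_edge ρ measurable_const measurable_const (measurable_insert_zero.comp
      (Config.measurable_insert.comp (measurable_const.prodMk measurable_fst))) measurable_snd
  obtain ⟨hVm, hV⟩ := lintegral_volume_annulus_diff hPiL hρ (norm_nonneg y)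
  have hball : volume (Metric.closedBall (0 : Plane) ‖y‖) ≠ ∞ := measure_closedBall_lt_top.ne
  have hJ := ofReal_exp_neg_mul_lintegral_le (μ := P.map PiL) hVm hball
    (fun φ => measure_mono (Set.inter_subset_left.trans Set.sdiff_subset)) lamE.2
  rw [hV, ENNReal.toReal_ofReal (by positivity)] at hJ
  refine hJ.trans ?_
  -- The order is swapped so that the eavesdroppers are integrated first, for fixed nodes; the inner
  -- integral is then a void probability.
  rw [lintegral_joint hPiL hPiE hindep hm, ← lintegral_prod_symm' _ hm,
    lintegral_prod _ hm.aemeasurable]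
  refine lintegral_mono fun φ => ?_
  have hK := measurableSet_exposedRegion ρ y ((φ.insert y).insert 0)
  have hKfin : volume (exposedRegion ρ y ((φ.insert y).insert 0).pts) ≠ ∞ :=
    ((measure_mono Set.inter_subset_left).trans_lt measure_closedBall_lt_top).ne
  simp only [edge_eq_indicator_void ρ hy]
  rw [lintegral_indicator_one (Config.measurableSet_void hK), hPiE.map_void hK hKfin]
  refine ENNReal.ofReal_le_ofReal (Real.exp_le_exp.2 (neg_le_neg
    (mul_le_mul_of_nonneg_left (ENNReal.toReal_mono ?_ (measure_mono ?_)) lamE.2)))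
  · exact ((measure_mono (Set.inter_subset_left.trans Set.sdiff_subset)).trans_lt
      hball.lt_top).ne
  -- The disc around `0` turns the disc of radius `‖y‖` into the annulus; the disc around `y` is
  -- given up.
  · rintro z ⟨hz, hz'⟩
    simp only [Set.mem_compl_iff, mem_neutralizationRegion, not_exists, not_and,
      Config.insert_pts] at hz'
    refine ⟨⟨hz, fun h => hz' 0 (by simp) h⟩, ?_⟩
    simp only [Set.mem_compl_iff, mem_neutralizationRegion, not_exists, not_and]
    exact fun x hx => hz' x (Or.inr (Or.inr hx))

end

/-! ### Radial integration and the final bounds -/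

theorem integral_radial {ρ k : ℝ} (hρ : 0 ≤ ρ) (hk : 0 < k) :
    IntegrableOn (fun r : ℝ => r * Real.exp (-(k * max 0 (r ^ 2 - ρ ^ 2)))) (Set.Ioi 0) ∧
    ∫ r in Set.Ioi (0 : ℝ), r * Real.exp (-(k * max 0 (r ^ 2 - ρ ^ 2))) =
      ρ ^ 2 / 2 + 1 / (2 * k) := by
  set f : ℝ → ℝ := fun r => r * Real.exp (-(k * max 0 (r ^ 2 - ρ ^ 2))) with hf
  have hcont : Continuous f := by fun_prop
  -- An antiderivative of the integrand beyond `ρ`; on `(0, ρ]` the truncation makes the integrand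
  -- equal to `r`.
  set g : ℝ → ℝ := fun r => -(1 / (2 * k)) * Real.exp (-(k * (r ^ 2 - ρ ^ 2))) with hg
  have hderiv : ∀ r ∈ Set.Ici ρ, HasDerivAt g (r * Real.exp (-(k * (r ^ 2 - ρ ^ 2)))) r := by
    intro r _
    have h := ((((hasDerivAt_pow 2 r).sub_const (ρ ^ 2)).const_mul k).neg.exp).const_mul
      (-(1 / (2 * k)))
    refine HasDerivAt.congr_deriv h ?_
    simp only [Nat.cast_ofNat, Nat.add_one_sub_one, pow_one, Pi.neg_apply]
    field_simp
  have hlim : Filter.Tendsto g Filter.atTop (nhds 0) := by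
    have h1 : Filter.Tendsto (fun r : ℝ => k * (r ^ 2 - ρ ^ 2)) Filter.atTop Filter.atTop :=
      (Filter.tendsto_atTop_add_const_right _ _
        (Filter.tendsto_pow_atTop two_ne_zero)).const_mul_atTop hk
    have h2 := (Real.tendsto_exp_neg_atTop_nhds_zero.comp h1).const_mul (-(1 / (2 * k)))
    rw [mul_zero] at h2
    exact h2
  have hpos : ∀ r ∈ Set.Ioi ρ, 0 ≤ r * Real.exp (-(k * (r ^ 2 - ρ ^ 2))) := fun r hr =>
    mul_nonneg (hρ.trans (le_of_lt hr)) (Real.exp_pos _).le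
  have heq : Set.EqOn (fun r => r * Real.exp (-(k * (r ^ 2 - ρ ^ 2)))) f (Set.Ioi ρ) :=
    fun r hr => by
      have : 0 ≤ r ^ 2 - ρ ^ 2 := by
        have : ρ < r := hr
        nlinarith
      simp only [hf, max_eq_right this]
  have heq' : Set.EqOn f (fun r => r) (Set.Ioc 0 ρ) := fun r hr => by
    have : r ^ 2 - ρ ^ 2 ≤ 0 := by nlinarith [hr.1, hr.2]
    simp [hf, max_eq_left this]
  have hi1 : IntegrableOn f (Set.Ioi ρ) :=
    (integrableOn_Ioi_deriv_of_nonneg' hderiv hpos hlim).congr_fun heq measurableSet_Ioi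
  have hi0 : IntegrableOn f (Set.Ioc 0 ρ) := hcont.integrableOn_Ioc
  have hU : Set.Ioi (0 : ℝ) = Set.Ioc 0 ρ ∪ Set.Ioi ρ := (Set.Ioc_union_Ioi_eq_Ioi hρ).symm
  rw [hU]
  refine ⟨hi0.union hi1, ?_⟩
  rw [setIntegral_union (Set.Ioc_disjoint_Ioi le_rfl) measurableSet_Ioi hi0 hi1,
    setIntegral_congr_fun measurableSet_Ioc heq', ← setIntegral_congr_fun measurableSet_Ioi heq,
    integral_Ioi_of_hasDerivAt_of_nonneg' hderiv hpos hlim,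
    ← intervalIntegral.integral_of_le hρ, integral_id]
  simp [hg]

theorem lintegral_plane_radial {ρ k : ℝ} (hρ : 0 ≤ ρ) (hk : 0 < k) :
    ∫⁻ y : Plane, ENNReal.ofReal (Real.exp (-(k * max 0 (‖y‖ ^ 2 - ρ ^ 2)))) =
      ENNReal.ofReal (Real.pi * (ρ ^ 2 + 1 / k)) := by
  obtain ⟨hi, hv⟩ := integral_radial hρ hk
  -- Polar coordinates contribute the weight `r` and the factor $2\pi$, the dimension times the area
  -- of the unit disc.
  have hd : Module.finrank ℝ Plane - 1 = 1 := by simp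
  have hball : (volume : Measure Plane).real (Metric.ball 0 1) = Real.pi := by
    rw [measureReal_def, EuclideanSpace.volume_ball_fin_two]
    simp [Real.pi_pos.le]
  have hint : Integrable (fun y : Plane => Real.exp (-(k * max 0 (‖y‖ ^ 2 - ρ ^ 2)))) := by
    refine (integrable_fun_norm_addHaar (volume : Measure Plane)
      (f := fun r => Real.exp (-(k * max 0 (r ^ 2 - ρ ^ 2))))).2 ?_
    simpa only [hd, pow_one, smul_eq_mul] using hi
  rw [← ofReal_integral_eq_lintegral_ofReal hint (.of_forall fun y => (Real.exp_pos _).le),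
    integral_fun_norm_addHaar (volume : Measure Plane)
      (fun r => Real.exp (-(k * max 0 (r ^ 2 - ρ ^ 2))))]
  simp only [hd, pow_one, smul_eq_mul, hv, hball]
  congr 1
  simp
  field_simp

theorem le_mean_Nout {Ω : Type*} [MeasurableSpace Ω] {P : Measure Ω} [IsProbabilityMeasure P]
    {PiL PiE : Ω → Config} {lamL lamE : ℝ≥0} (hE : 0 < lamE)
    (hPiL : IsPoissonProcess P PiL lamL) (hPiE : IsPoissonProcess P PiE lamE)
    (hindep : IndepFun PiL PiE P) {ρ : ℝ} (hρ : 0 ≤ ρ) :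
    ENNReal.ofReal ((lamL / lamE : ℝ) *
        (Real.pi * lamE * ρ ^ 2 + Real.exp (Real.pi * lamL * ρ ^ 2))) ≤
      mean P (Nout PiL PiE ρ) := by
  have hE' : (0 : ℝ) < lamE := hE
  -- The exponential rate in $|y|^2-\rho^2$ after Jensen. The term $\lambda_\ell\pi/k$ equals
  -- $(\lambda_\ell/\lambda_e)e^{\pi\lambda_\ell\rho^2}$.
  set k : ℝ := lamE * (Real.exp (-(Real.pi * lamL * ρ ^ 2)) * Real.pi) with hk
  have hk0 : 0 < k := by positivity
  have h1 : ENNReal.ofReal (Real.pi * (ρ ^ 2 + 1 / k)) ≤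
      ∫⁻ y, ∫⁻ ω, edge ρ 0 y (((PiL ω).insert y).insert 0) (PiE ω) ∂P := by
    rw [← lintegral_plane_radial hρ hk0]
    refine lintegral_mono_ae ?_
    filter_upwards [Measure.ae_ne volume (0 : Plane)] with y hy
    refine le_trans (le_of_eq ?_) (le_lintegral_edge hPiL hPiE hindep hρ hy)
    rw [hk]
    congr 3
    ring
  rw [mean_Nout hPiL hPiE hindep]
  refine le_trans (le_of_eq ?_) (mul_le_mul_right h1 _)
  rw [← ENNReal.ofReal_coe_nnreal, ← ENNReal.ofReal_mul lamL.coe_nonneg]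
  congr 1
  rw [hk, Real.exp_neg]
  field_simp

theorem exists_mul_exp_le {lamL lamE : ℝ} (hL : 0 < lamL) (hE : 0 < lamE) (a : ℝ) :
    ∃ c : ℝ, 0 < c ∧ ∀ ρ : ℝ, c * Real.exp (a * ρ) ≤
      lamL / lamE * (Real.pi * lamE * ρ ^ 2 + Real.exp (Real.pi * lamL * ρ ^ 2)) := by
  have hπ := Real.pi_pos
  -- The constant comes from completing the square in $\pi\lambda_\ell\rho^2-a\rho$, whose minimum
  -- is $-a^2/(4\pi\lambda_\ell)$; the quadratic term of the bound is dropped.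
  refine ⟨lamL / lamE * Real.exp (-(a ^ 2 / (4 * (Real.pi * lamL)))), by positivity, fun ρ => ?_⟩
  rw [mul_assoc, ← Real.exp_add]
  refine mul_le_mul_of_nonneg_left ?_ (by positivity)
  have h : -(a ^ 2 / (4 * (Real.pi * lamL))) + a * ρ ≤ Real.pi * lamL * ρ ^ 2 := by
    have : Real.pi * lamL * ρ ^ 2 - a * ρ + a ^ 2 / (4 * (Real.pi * lamL)) =
        (2 * (Real.pi * lamL) * ρ - a) ^ 2 / (4 * (Real.pi * lamL)) := by
      field_simp
      ring
    have h2 : 0 ≤ (2 * (Real.pi * lamL) * ρ - a) ^ 2 / (4 * (Real.pi * lamL)) := by positivity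
    linarith
  exact (Real.exp_le_exp.2 h).trans (le_add_of_nonneg_left (by positivity))

theorem mainTheorem8 {Ω : Type*} [MeasurableSpace Ω] (P : Measure Ω) [IsProbabilityMeasure P]
    (PiL PiE : Ω → Config) (lamL lamE : ℝ≥0) (hL : 0 < lamL) (hE : 0 < lamE)
    (hPiL : IsPoissonProcess P PiL lamL) (hPiE : IsPoissonProcess P PiE lamE)
    (hindep : IndepFun PiL PiE P) :
    (∀ ρ : ℝ, 0 ≤ ρ →
      -- the degrees of the node at the origin are random variables
      Measurable (Nin PiL PiE ρ) ∧ Measurable (Nout PiL PiE ρ) ∧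
      -- their means are the average degrees of a typical node (Palm averages)
      (∀ W : Set Plane, MeasurableSet W → volume W ≠ 0 → volume W ≠ ∞ →
        palmMean P PiL W (fun ω => inDeg (poissonGraph PiL PiE ρ ω)) = mean P (Nin PiL PiE ρ) ∧
        palmMean P PiL W (fun ω => outDeg (poissonGraph PiL PiE ρ ω)) =
          mean P (Nout PiL PiE ρ)) ∧
      mean P (Nin PiL PiE ρ) = mean P (Nout PiL PiE ρ) ∧
      ENNReal.ofReal ((lamL / lamE : ℝ) *
          (Real.pi * lamE * ρ ^ 2 + Real.exp (Real.pi * lamL * ρ ^ 2))) ≤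
        mean P (Nout PiL PiE ρ)) ∧
    -- the average degrees grow at least exponentially in the radius, with any rate `a`
    (∀ a : ℝ, ∃ c : ℝ, 0 < c ∧ ∀ ρ : ℝ, 0 ≤ ρ →
      ENNReal.ofReal (c * Real.exp (a * ρ)) ≤ mean P (Nin PiL PiE ρ) ∧
      ENNReal.ofReal (c * Real.exp (a * ρ)) ≤ mean P (Nout PiL PiE ρ)) := by
  have hlow : ∀ ρ : ℝ, 0 ≤ ρ → _ := fun ρ hρ => le_mean_Nout hE hPiL hPiE hindep hρ
  have heq := mean_Nin_eq_mean_Nout hPiL hPiE hindep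
  refine ⟨fun ρ hρ => ⟨measurable_Nin hPiL.measurable hPiE.measurable ρ,
    measurable_Nout hPiL.measurable hPiE.measurable ρ, fun W hW hW0 hW1 => ⟨?_, ?_⟩, heq ρ,
    hlow ρ hρ⟩, fun a => ?_⟩
  · exact palmMean_eq_mean hPiL hPiE hindep hL
      (D := fun x φ ψ => inDeg (secrecyGraph φ.pts ψ.pts ρ) x) (measurable_inDeg ρ)
      (fun _ _ _ _ => inDeg_translate) hW hW0 hW1
  · exact palmMean_eq_mean hPiL hPiE hindep hL
      (D := fun x φ ψ => outDeg (secrecyGraph φ.pts ψ.pts ρ) x) (measurable_outDeg ρ)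
      (fun _ _ _ _ => outDeg_translate) hW hW0 hW1
  · obtain ⟨c, hc, h⟩ := exists_mul_exp_le (lamL := lamL) (lamE := lamE) hL hE a
    refine ⟨c, hc, fun ρ hρ => ?_⟩
    have := (ENNReal.ofReal_le_ofReal (h ρ)).trans (hlow ρ hρ)
    exact ⟨this.trans (heq ρ).ge, this⟩
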